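/- **Definitions.** An *extended surface* $\Sigma$ is a compact oriented smooth $2$-manifold, possibly with boundary and possibly disconnected, with one marked point chosen on every boundary circle. The *genus* of a surface is the genus of the surface without boundary obtained by gluing a disk to every boundary circle; equivalently, it is the maximal number of pairwise disjoint smooth simple closed curves in the interior whose removal does not disconnect any connected component. A *cut system* on $\Sigma$ is a finite (possibly empty) set $C$ of pairwise disjoint smooth simple closed curves ("cuts", neither oriented nor ordered) in the interior of $\Sigma$ such that every connected component of $\Sigma\setminus C$ has genus $0$. A cut $c\in C$ is *removable* if $C\setminus\{c\}$ is again a cut system. Everything is considered up to isotopy of $\Sigma$ (ambient isotopy fixing the marked points). Let $\mathcal C(\Sigma)$ be the following $2$-dimensional CW complex. * Its vertices are the isotopy classes of cut systems on $\Sigma$. * Its directed edges are the moves $\bar F_c\colon C\to C\setminus\{c\}$, one for each isotopy class of pairs consisting of a cut system $C$ and a removable cut $c\in C$. * Its $2$-cells are the relations of associativity of cut removal, $\bar F_{c_1}\bar F_{c_2}(C)=\bar F_{c_2}\bar F_{c_1}(C)$: for each isotopy class of a cut system $C$ with an unordered pair of distinct cuts $c_1,c_2\in C$ such that $C\setminus\{c_1\}$,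 $C\setminus\{c_2\}$ and $C\setminus\{c_1,c_2\}$ are cut systems, one square is attached along the two edge paths $C\to C\setminus\{c_1\}\to C\setminus\{c_1,c_2\}$ and $C\to C\setminus\{c_2\}\to C\setminus\{c_1,c_2\}$. **Theorem.** If $\Sigma$ is an extended surface of genus $0$, then $\mathcal C(\Sigma)$ is connected and simply-connected. -/

import Mathlib

open Set Topology
open scoped Manifold ContDiff unitInterval

noncomputable section

namespace CutComplex

universe u

/-! ### Moving collections of curves -/

section Move

variable {M : Type u} [TopologicalSpace M]

/-- The collection of the images of the curves of `C` under `φ`. -/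
def moveCurves (φ : M ≃ₜ M) (C : Set (Set M)) : Set (Set M) := (fun c => φ '' c) '' C

theorem moveCurves_refl (C : Set (Set M)) : moveCurves (Homeomorph.refl M) C = C := by
  simp [moveCurves]

theorem moveCurves_trans (φ ψ : M ≃ₜ M) (C : Set (Set M)) :
    moveCurves (φ.trans ψ) C = moveCurves ψ (moveCurves φ C) := by
  simp only [moveCurves, image_image]
  rfl

theorem image_symm_of_image {φ : M ≃ₜ M} {c c' : Set M} (h : φ '' c = c') :
    φ.symm '' c' = c := by
  simp [← h, image_image]

theorem moveCurves_symm {φ : M ≃ₜ M} {C C' : Set (Set M)} (h : moveCurves φ C = C') :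
    moveCurves φ.symm C' = C := by
  simp [← h, moveCurves, image_image]

theorem moveCurves_diff {φ : M ≃ₜ M} {C C' : Set (Set M)} {c c' : Set M}
    (h : moveCurves φ C = C') (hc : φ '' c = c') :
    moveCurves φ (C \ {c}) = C' \ {c'} := by
  rw [← h, ← hc]
  simp only [moveCurves]
  rw [image_sdiff φ.injective.image_injective, image_singleton]

end Move

/-! ### Extended surfaces, simple closed curves, genus -/

section Surface

variable (M : Type u) [TopologicalSpace M] [ChartedSpace (EuclideanHalfSpace 2) M]

/-- The structure of an extended surface on a smooth `2`-manifold with boundary `M`: an orientation,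
given by an atlas of smooth charts with orientation preserving coordinate changes, and one marked
point on every component of the boundary. (That `M` is smooth, compact and Hausdorff is asked for
by type classes.) -/
structure ESurface where
  /-- The positively oriented charts. -/
  orientedAtlas : Set (OpenPartialHomeomorph M (EuclideanHalfSpace 2))
  smooth_charts : orientedAtlas ⊆ IsManifold.maximalAtlas (𝓡∂ 2) ∞ M
  charts_cover : ∀ x : M, ∃ e ∈ orientedAtlas, x ∈ e.source
  det_pos : ∀ e ∈ orientedAtlas, ∀ e' ∈ orientedAtlas, ∀ x ∈ e.source ∩ e'.source,
    0 < (fderivWithin ℝ (e'.extend (𝓡∂ 2) ∘ (e.extend (𝓡∂ 2)).symm) (range (𝓡∂ 2))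
      (e.extend (𝓡∂ 2) x)).det
  /-- The marked points. -/
  marked : Set M
  marked_subset : marked ⊆ (𝓡∂ 2).boundary M
  existsUnique_marked : ∀ x ∈ (𝓡∂ 2).boundary M,
    ∃! p, p ∈ marked ∧ p ∈ connectedComponentIn ((𝓡∂ 2).boundary M) x

variable {M}

/-- An (unoriented, unparameterized) smooth simple closed curve in the interior of `M`. -/
def IsSimpleClosedCurve (c : Set M) : Prop :=
  (∃ γ : Circle → M, Manifold.IsSmoothEmbedding (𝓡 1) (𝓡∂ 2) ∞ γ ∧ range γ = c) ∧
    c ⊆ (𝓡∂ 2).interior M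

/-- A finite collection of pairwise non-intersecting smooth simple closed curves. -/
def IsCurveSystem (C : Set (Set M)) : Prop :=
  C.Finite ∧ (∀ c ∈ C, IsSimpleClosedCurve c) ∧ C.PairwiseDisjoint id

/-- Removing the curves of `F` from `U` disconnects no connected component of `U`. -/
def IsNonseparating (U : Set M) (F : Set (Set M)) : Prop :=
  ∀ x ∈ U, IsConnected (connectedComponentIn U x \ ⋃₀ F)

/-- The genus of a region `U` of `M`: the maximal number of non-intersecting simple closed curves
in the interior of `U` whose removal disconnects no component of `U`. Gluing disks to boundary
circles does not change this number, and it is additive over connected components. -/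
def genus (U : Set M) : ℕ∞ :=
  ⨆ F : {F : Set (Set M) // IsCurveSystem F ∧ ⋃₀ F ⊆ U ∧ IsNonseparating U F}, F.1.encard

/-- A cut system: a finite collection of non-intersecting simple closed curves such that each
connected component of the complement has genus `0`. -/
def IsCutSystem (C : Set (Set M)) : Prop :=
  IsCurveSystem C ∧ ∀ x ∈ (⋃₀ C)ᶜ, genus (connectedComponentIn (⋃₀ C)ᶜ x) = 0

namespace ESurface

variable (S : ESurface M)

/-- The genus of the surface. -/
def surfaceGenus (_S : ESurface M) : ℕ∞ := genus (univ : Set M)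

/-- `φ` is the end of an isotopy of the surface which starts at the identity and keeps the marked
points fixed. -/
def IsotopicToId (φ : M ≃ₜ M) : Prop :=
  ∃ H : I → M ≃ₜ M, Continuous (fun p : I × M => H p.1 p.2) ∧
    Continuous (fun p : I × M => (H p.1).symm p.2) ∧
    H 0 = Homeomorph.refl M ∧ H 1 = φ ∧ ∀ t, ∀ p ∈ S.marked, H t p = p

variable {S}

theorem IsotopicToId.refl : S.IsotopicToId (Homeomorph.refl M) :=
  ⟨fun _ => Homeomorph.refl M, continuous_snd, continuous_snd, rfl, rfl, fun _ _ _ => rfl⟩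

theorem IsotopicToId.symm {φ : M ≃ₜ M} (h : S.IsotopicToId φ) : S.IsotopicToId φ.symm := by
  obtain ⟨H, h1, h2, h3, h4, h5⟩ := h
  refine ⟨fun t => (H t).symm, h2, h1, ?_, ?_, fun t p hp => ?_⟩
  · simp only [h3]; rfl
  · simp only [h4]
  · rw [Homeomorph.symm_apply_eq, h5 t p hp]

theorem IsotopicToId.trans {φ ψ : M ≃ₜ M} (h : S.IsotopicToId φ) (h' : S.IsotopicToId ψ) :
    S.IsotopicToId (φ.trans ψ) := by
  obtain ⟨H, h1, h2, h3, h4, h5⟩ := h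
  obtain ⟨K, k1, k2, k3, k4, k5⟩ := h'
  refine ⟨fun t => (H t).trans (K t), ?_, ?_, ?_, ?_, fun t p hp => ?_⟩
  · exact k1.comp (continuous_fst.prodMk h1)
  · exact h2.comp (continuous_fst.prodMk k2)
  · simp only [h3, k3]; rfl
  · simp only [h4, k4]
  · simp [h5 t p hp, k5 t p hp]

end ESurface

variable (M)

/-- A cut system. -/
structure CutSystem where
  cuts : Set (Set M)
  isCutSystem : IsCutSystem cuts

/-- A cut system with a removable cut `c`. -/
structure PointedCutSystem where
  cuts : Set (Set M)
  c : Set M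
  mem : c ∈ cuts
  isCutSystem : IsCutSystem cuts
  removable : IsCutSystem (cuts \ {c})

/-- A cut system with two distinct cuts which can be removed one after the other, in any order. -/
structure BipointedCutSystem where
  cuts : Set (Set M)
  c₁ : Set M
  c₂ : Set M
  mem₁ : c₁ ∈ cuts
  mem₂ : c₂ ∈ cuts
  ne : c₁ ≠ c₂
  isCutSystem : IsCutSystem cuts
  removable₁ : IsCutSystem (cuts \ {c₁})
  removable₂ : IsCutSystem (cuts \ {c₂})
  removable₁₂ : IsCutSystem ((cuts \ {c₁}) \ {c₂})

variable {M}

namespace PointedCutSystem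

/-- The cut system from which the cut is to be removed. -/
def before (p : PointedCutSystem M) : CutSystem M := ⟨p.cuts, p.isCutSystem⟩

/-- The cut system that remains after the cut is removed. -/
def after (p : PointedCutSystem M) : CutSystem M := ⟨p.cuts \ {p.c}, p.removable⟩

end PointedCutSystem

namespace BipointedCutSystem

variable (q : BipointedCutSystem M)

/-- Remove `c₁` from `C`. -/
def first₁ : PointedCutSystem M := ⟨q.cuts, q.c₁, q.mem₁, q.isCutSystem, q.removable₁⟩

/-- Remove `c₂` from `C`. -/
def first₂ : PointedCutSystem M := ⟨q.cuts, q.c₂, q.mem₂, q.isCutSystem, q.removable₂⟩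

/-- Remove `c₂` from `C \ {c₁}`. -/
def second₂ : PointedCutSystem M :=
  ⟨q.cuts \ {q.c₁}, q.c₂, ⟨q.mem₂, fun h => q.ne h.symm⟩, q.removable₁, q.removable₁₂⟩

/-- Remove `c₁` from `C \ {c₂}`. -/
def second₁ : PointedCutSystem M :=
  ⟨q.cuts \ {q.c₂}, q.c₁, ⟨q.mem₁, fun h => q.ne h⟩, q.removable₂, by
    rw [_root_.sdiff_sdiff_comm]; exact q.removable₁₂⟩

end BipointedCutSystem

/-! ### Isotopy classes -/

namespace ESurface

variable (S : ESurface M)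

/-- Isotopy of cut systems. -/
def cutSetoid : Setoid (CutSystem M) where
  r C C' := ∃ φ, S.IsotopicToId φ ∧ moveCurves φ C.cuts = C'.cuts
  iseqv :=
    { refl := fun C => ⟨_, .refl, moveCurves_refl _⟩
      symm := fun ⟨φ, h, h'⟩ => ⟨φ.symm, h.symm, moveCurves_symm h'⟩
      trans := fun ⟨φ, h, h'⟩ ⟨ψ, k, k'⟩ =>
        ⟨φ.trans ψ, h.trans k, by rw [moveCurves_trans, h', k']⟩ }

/-- Isotopy of cut systems with a removable cut. -/
def pointedSetoid : Setoid (PointedCutSystem M) where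
  r p p' := ∃ φ, S.IsotopicToId φ ∧ moveCurves φ p.cuts = p'.cuts ∧ φ '' p.c = p'.c
  iseqv :=
    { refl := fun p => ⟨_, .refl, moveCurves_refl _, by simp⟩
      symm := fun ⟨φ, h, h', h''⟩ =>
        ⟨φ.symm, h.symm, moveCurves_symm h', image_symm_of_image h''⟩
      trans := fun ⟨φ, h, h', h''⟩ ⟨ψ, k, k', k''⟩ =>
        ⟨φ.trans ψ, h.trans k, by rw [moveCurves_trans, h', k'], by
          rw [← k'', ← h'', image_image]; rfl⟩ }

/-- Isotopy of cut systems with two distinguished cuts, the order of the two being irrelevant. -/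
def bipointedSetoid : Setoid (BipointedCutSystem M) where
  r q q' := ∃ φ, S.IsotopicToId φ ∧ moveCurves φ q.cuts = q'.cuts ∧
    moveCurves φ {q.c₁, q.c₂} = {q'.c₁, q'.c₂}
  iseqv :=
    { refl := fun q => ⟨_, .refl, moveCurves_refl _, moveCurves_refl _⟩
      symm := fun ⟨φ, h, h', h''⟩ => ⟨φ.symm, h.symm, moveCurves_symm h', moveCurves_symm h''⟩
      trans := fun ⟨φ, h, h', h''⟩ ⟨ψ, k, k', k''⟩ =>
        ⟨φ.trans ψ, h.trans k, by rw [moveCurves_trans, h', k'], by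
          rw [moveCurves_trans, h'', k'']⟩ }

/-- Cut systems up to isotopy. -/
abbrev Vertex : Type u := Quotient S.cutSetoid

/-- The moves which remove one cut, up to isotopy. -/
abbrev Edge : Type u := Quotient S.pointedSetoid

/-- The relations `F_{c₁} F_{c₂} = F_{c₂} F_{c₁}`, up to isotopy. -/
abbrev Cell : Type u := Quotient S.bipointedSetoid

/-- The class of a cut system. -/
def vertex (C : CutSystem M) : S.Vertex := Quotient.mk S.cutSetoid C

/-- The class of a move. -/
def edge (p : PointedCutSystem M) : S.Edge := Quotient.mk S.pointedSetoid p

/-- The move `C → C \ {c}` starts at `C`. -/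
def source : S.Edge → S.Vertex :=
  Quotient.lift (fun p => S.vertex p.before) fun _ _ ⟨φ, h, h', _⟩ =>
    Quotient.sound (s := S.cutSetoid) ⟨φ, h, h'⟩

/-- The move `C → C \ {c}` ends at `C \ {c}`. -/
def target : S.Edge → S.Vertex :=
  Quotient.lift (fun p => S.vertex p.after) fun _ _ ⟨φ, h, h', h''⟩ =>
    Quotient.sound (s := S.cutSetoid) ⟨φ, h, moveCurves_diff h' h''⟩

end ESurface

end Surface

/-! ### Two-dimensional complexes -/

/-- The combinatorial data of a two-dimensional CW complex with directed edges whose `2`-cells are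
squares: a square is attached along
```
  · --top--→ ·
  ↑          ↑
 left      right
  |          |
  · -bottom→ ·
```
-/
structure SquareComplex where
  V : Type u
  E : Type u
  F : Type u
  src : E → V
  tgt : E → V
  bottom : F → E
  top : F → E
  left : F → E
  right : F → E
  src_bottom : ∀ f, src (bottom f) = src (left f)
  tgt_bottom : ∀ f, tgt (bottom f) = src (right f)
  tgt_left : ∀ f, tgt (left f) = src (top f)
  tgt_right : ∀ f, tgt (right f) = tgt (top f)

namespace SquareComplex

variable (K : SquareComplex.{u})

/-- The disjoint union of the closed cells: points, intervals and squares. -/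
abbrev Cells : Type u := (Σ _ : K.V, Unit) ⊕ (Σ _ : K.E, I) ⊕ (Σ _ : K.F, I × I)

variable {K}

/-- The point of `K.Cells` given by a vertex. -/
def vertexPt (v : K.V) : K.Cells := .inl ⟨v, ()⟩

/-- A point on the closed interval of an edge, directed from `0` to `1`. -/
def edgePt (e : K.E) (t : I) : K.Cells := .inr (.inl ⟨e, t⟩)

/-- A point of a closed square. -/
def squarePt (f : K.F) (a b : I) : K.Cells := .inr (.inr ⟨f, (a, b)⟩)

/-- The attaching of the ends of the edges to vertices and of the sides of the squares to edges. -/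
inductive Glue : K.Cells → K.Cells → Prop
  | src (e : K.E) : Glue (edgePt e 0) (vertexPt (K.src e))
  | tgt (e : K.E) : Glue (edgePt e 1) (vertexPt (K.tgt e))
  | bottom (f : K.F) (t : I) : Glue (squarePt f t 0) (edgePt (K.bottom f) t)
  | top (f : K.F) (t : I) : Glue (squarePt f t 1) (edgePt (K.top f) t)
  | left (f : K.F) (t : I) : Glue (squarePt f 0 t) (edgePt (K.left f) t)
  | right (f : K.F) (t : I) : Glue (squarePt f 1 t) (edgePt (K.right f) t)

variable (K)

/-- The topological space of the complex, with the quotient (that is, weak) topology. -/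
def Realization : Type u := Quot (Glue (K := K))

instance : TopologicalSpace K.Realization :=
  inferInstanceAs (TopologicalSpace (Quot (Glue (K := K))))

end SquareComplex

/-! ### The complex of cut systems -/

/-- The complex `𝒞(Σ)`: the vertices are the cut systems, the edges are the moves `F_c : C → C \ {c}`
for removable cuts `c`, and there is one `2`-cell for each relation
`F_{c₁} F_{c₂} (C) = F_{c₂} F_{c₁} (C)`, all up to isotopy. For the parameterization of a `2`-cell one
of the two orders of `c₁`, `c₂` is chosen. -/
def cutComplex {M : Type u} [TopologicalSpace M] [ChartedSpace (EuclideanHalfSpace 2) M]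
    (S : ESurface M) : SquareComplex.{u} where
  V := S.Vertex
  E := S.Edge
  F := S.Cell
  src := S.source
  tgt := S.target
  bottom f := S.edge f.out.first₁
  right f := S.edge f.out.second₂
  left f := S.edge f.out.first₂
  top f := S.edge f.out.second₁
  src_bottom _ := rfl
  tgt_bottom _ := rfl
  tgt_left _ := rfl
  tgt_right f := by
    change S.vertex _ = S.vertex _
    congr 1
    simp only [PointedCutSystem.after, BipointedCutSystem.second₁, BipointedCutSystem.second₂,
      CutSystem.mk.injEq]
    exact _root_.sdiff_sdiff_comm

end CutComplex

end

/-!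
Removing cuts one after the other leads from every cut system to the empty one. On a surface of
genus `0` every cut is removable, so any two removals from the same cut system span a square, and by
the diamond lemma the descending edge paths give every vertex a path class to the base point,
compatibly with all the edges. These classes extend to all points of the complex through the cells.
The extended family is locally parallel: a self-map of the interval which is constant near both ends
acts on the whole complex, moving every point within its cell, and near a given point it can be
chosen to be locally constant. A locally parallel family is parallel along every path, so every path
from `x` to `y` has the class `d x - d y` determined by the classes `d` of its ends.
-/

namespace CutComplex

universe u

/-! ### Parallel families of path classes -/

section Parallel

open Path.Homotopic.Quotient

variable {X : Type*} [TopologicalSpace X] {b : X}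

/-- The family `h` of classes of paths to `b` is parallel along `p`: its value at the start of `p`
is obtained by first following `p`. -/
def IsParallel (h : ∀ x : X, Path.Homotopic.Quotient x b) {x y : X} (p : Path x y) : Prop :=
  (mk p).trans (h y) = h x

variable {h : ∀ x : X, Path.Homotopic.Quotient x b}

theorem IsParallel.congr {x y x' y' : X} {p : Path x y} {p' : Path x' y'}
    (hp : IsParallel h p) (e : ∀ t, p t = p' t) : IsParallel h p' := by
  obtain rfl : x = x' := by simpa using e 0
  obtain rfl : y = y' := by simpa using e 1
  obtain rfl : p = p' := Path.ext (funext e)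
  exact hp

theorem IsParallel.refl (x : X) : IsParallel h (Path.refl x) := by
  simp [IsParallel]

theorem IsParallel.symm {x y : X} {p : Path x y} (hp : IsParallel h p) :
    IsParallel h p.symm := by
  rw [IsParallel, ← hp, mk_symm, ← Path.Homotopic.Quotient.trans_assoc]
  simp

theorem IsParallel.trans {x y z : X} {p : Path x y} {p' : Path y z} (hp : IsParallel h p)
    (hp' : IsParallel h p') : IsParallel h (p.trans p') := by
  rw [IsParallel, ← hp, ← hp', mk_trans, Path.Homotopic.Quotient.trans_assoc]

theorem IsParallel.of_homotopic {x y : X} {p p' : Path x y} (hp : IsParallel h p)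
    (e : p.Homotopic p') : IsParallel h p' := by
  rwa [IsParallel, ← Path.Homotopic.Quotient.eq.2 e]

theorem IsParallel.of_local
    (hloc : ∀ x : X, ∃ U ∈ 𝓝 x, ∀ {y z : X} (p : Path y z), (∀ t, p t ∈ U) → IsParallel h p)
    {x y : X} (p : Path x y) : IsParallel h p := by
  suffices key : IsParallel h (p.subpath 0 1) from key.congr fun t => by simp
  refine PreconnectedSpace.induction₂' (fun s t => IsParallel h (p.subpath s t)) (fun s => ?_)
    ⟨fun r s t h₁ h₂ => (h₁.trans h₂).of_homotopic ⟨Path.Homotopy.subpathTransSubpath p r s t⟩⟩ 0 1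
  obtain ⟨U, hU, hp⟩ := hloc (p s)
  have hc : Continuous fun q : I × I => p.subpath s q.1 q.2 :=
    p.subpath_continuous_family.comp (by fun_prop : Continuous fun q : I × I => (s, q.1, q.2))
  have short : ∀ᶠ t in 𝓝 s, ∀ r ∈ (univ : Set I), p.subpath s t r ∈ U :=
    isCompact_univ.eventually_forall_of_forall_eventually fun r _ =>
      hc.continuousAt.preimage_mem_nhds (by simpa using hU)
  filter_upwards [short] with t ht
  have hst : IsParallel h (p.subpath s t) := hp _ fun r => ht r trivial
  exact ⟨hst, by simpa using hst.symm⟩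

theorem simplyConnectedSpace_of_isParallel
    (hp : ∀ {x y : X} (p : Path x y), IsParallel h p) : SimplyConnectedSpace X := by
  rw [simply_connected_iff_paths_homotopic']
  refine ⟨⟨⟨b⟩, fun x y => ⟨(h x).out.trans (h y).out.symm⟩⟩, fun {x y} p p' => ?_⟩
  rw [← Path.Homotopic.Quotient.eq]
  have e : (mk p).trans (h y) = (mk p').trans (h y) := Eq.trans (hp p) (Eq.symm (hp p'))
  simpa [Path.Homotopic.Quotient.trans_assoc] using congrArg (fun c => c.trans (h y).symm) e

variable {D D' : Type*} [TopologicalSpace D] [TopologicalSpace D']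

/-- The family `h` is parallel along the images under `g` of the paths from `u` to `v`. -/
def IsFlat (h : ∀ x : X, Path.Homotopic.Quotient x b) (g : C(D, X)) (u v : D) : Prop :=
  ∀ p : Path u v, IsParallel h (p.map g.continuous)

theorem IsFlat.symm {g : C(D, X)} {u v : D} (huv : IsFlat h g u v) : IsFlat h g v u :=
  fun p => (huv p.symm).symm.congr fun t => by simp

theorem IsFlat.const (x : X) (u v : D) : IsFlat h (.const D x) u v :=
  fun _ => (IsParallel.refl x).congr fun _ => rfl

theorem IsFlat.comp {g : C(D, X)} {k : C(D', D)} {u v : D'} (huv : IsFlat h g (k u) (k v)) :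
    IsFlat h (g.comp k) u v :=
  fun p => huv (p.map k.continuous)

section SimplyConnected

variable [SimplyConnectedSpace D]

theorem IsFlat.of_path {g : C(D, X)} {u v : D} {p : Path u v}
    (hp : IsParallel h (p.map g.continuous)) : IsFlat h g u v := fun p' =>
  hp.of_homotopic ((SimplyConnectedSpace.paths_homotopic p p').map g)

theorem IsFlat.refl (g : C(D, X)) (u : D) : IsFlat h g u u :=
  IsFlat.of_path (p := Path.refl u) ((IsParallel.refl (g u)).congr fun _ => rfl)

theorem IsFlat.trans {g : C(D, X)} {u v w : D} (huv : IsFlat h g u v) (hvw : IsFlat h g v w) :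
    IsFlat h g u w := by
  have p := PathConnectedSpace.somePath u v
  have p' := PathConnectedSpace.somePath v w
  refine IsFlat.of_path (p := p.trans p') ?_
  rw [Path.map_trans]
  exact (huv p).trans (hvw p')

theorem IsFlat.of_comp [PathConnectedSpace D'] {g : C(D, X)} {k : C(D', D)} {u v : D'}
    (huv : IsFlat h (g.comp k) u v) : IsFlat h g (k u) (k v) :=
  IsFlat.of_path (p := (PathConnectedSpace.somePath u v).map k.continuous) (huv _)

theorem homotopic_of_eq_comp {x y : X} {p p' : Path x y} (g : C(D, X)) {u v : D} (q q' : Path u v)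
    (hp : ∀ t, p t = g (q t)) (hp' : ∀ t, p' t = g (q' t)) : p.Homotopic p' := by
  obtain rfl : g u = x := by simpa using (hp 0).symm
  obtain rfl : g v = y := by simpa using (hp 1).symm
  obtain rfl : q.map g.continuous = p := Path.ext (funext fun t => (hp t).symm)
  obtain rfl : q'.map g.continuous = p' := Path.ext (funext fun t => (hp' t).symm)
  exact (SimplyConnectedSpace.paths_homotopic q q').map g

end SimplyConnected

end Parallel

instance : ContractibleSpace I :=
  (convex_Icc (0 : ℝ) 1).contractibleSpace ⟨0, by simp⟩

namespace SquareComplex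

variable {K : SquareComplex.{u}}

/-! ### Characteristic maps of the cells -/

/-- The quotient map from the closed cells to the complex. -/
def proj (z : K.Cells) : K.Realization := Quot.mk _ z

theorem isQuotientMap_proj : IsQuotientMap (proj : K.Cells → K.Realization) :=
  isQuotientMap_quot_mk

theorem proj_eq {z z' : K.Cells} (hz : Glue z z') : proj z = proj z' := Quot.sound hz

/-- The point of the complex given by a vertex. -/
def vertexMap (v : K.V) : K.Realization := proj (vertexPt v)

/-- The characteristic map of an edge. -/
def edgeMap (e : K.E) : C(I, K.Realization) where
  toFun t := proj (edgePt e t)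
  continuous_toFun := isQuotientMap_proj.continuous.comp
    (continuous_inr.comp (continuous_inl.comp continuous_sigmaMk))

/-- The characteristic map of a square. -/
def squareMap (f : K.F) : C(I × I, K.Realization) where
  toFun p := proj (squarePt f p.1 p.2)
  continuous_toFun := isQuotientMap_proj.continuous.comp (continuous_inr.comp (continuous_inr.comp
    (continuous_sigmaMk : Continuous (Sigma.mk (β := fun _ : K.F => I × I) f))))

/-- The horizontal line at height `s` in the square. -/
def horizontal (s : I) : C(I, I × I) := ⟨fun t => (t, s), by fun_prop⟩

/-- The vertical line over `s` in the square. -/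
def vertical (s : I) : C(I, I × I) := ⟨fun t => (s, t), by fun_prop⟩

theorem edgeMap_zero (e : K.E) : edgeMap e 0 = vertexMap (K.src e) := proj_eq (.src e)

theorem edgeMap_one (e : K.E) : edgeMap e 1 = vertexMap (K.tgt e) := proj_eq (.tgt e)

theorem squareMap_bottom (f : K.F) : (squareMap f).comp (horizontal 0) = edgeMap (K.bottom f) :=
  ContinuousMap.ext fun t => proj_eq (.bottom f t)

theorem squareMap_top (f : K.F) : (squareMap f).comp (horizontal 1) = edgeMap (K.top f) :=
  ContinuousMap.ext fun t => proj_eq (.top f t)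

theorem squareMap_left (f : K.F) : (squareMap f).comp (vertical 0) = edgeMap (K.left f) :=
  ContinuousMap.ext fun t => proj_eq (.left f t)

theorem squareMap_right (f : K.F) : (squareMap f).comp (vertical 1) = edgeMap (K.right f) :=
  ContinuousMap.ext fun t => proj_eq (.right f t)

/-- The characteristic map of the cell of a point. To treat all cells alike it is defined on the
square also for vertices and edges, and then does not depend on the superfluous coordinates. -/
def cellMap : K.Cells → C(I × I, K.Realization)
  | .inl v => .const _ (vertexMap v.1)
  | .inr (.inl p) => (edgeMap p.1).comp .fst
  | .inr (.inr p) => squareMap p.1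

/-- The coordinates of a point of a cell, with the superfluous ones equal to `0`. -/
def coord : K.Cells → I × I
  | .inl _ => (0, 0)
  | .inr (.inl p) => (p.2, 0)
  | .inr (.inr p) => p.2

theorem cellMap_coord (z : K.Cells) : cellMap z (coord z) = proj z := by
  rcases z with v | p | p <;> rfl

theorem exists_cellMap_one_eq (z : K.Cells) : ∃ v, cellMap z (1, 1) = vertexMap v := by
  rcases z with v | p | p
  · exact ⟨_, rfl⟩
  · exact ⟨_, edgeMap_one p.1⟩
  · exact ⟨_, (proj_eq (.top p.1 1)).trans (edgeMap_one _)⟩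

theorem isLocallyConstant_cellMap : IsLocallyConstant (cellMap (K := K)) := by
  intro s
  simp only [isOpen_sum_iff, isOpen_sigma_iff]
  exact ⟨fun v => isOpen_const (p := cellMap (vertexPt v) ∈ s),
    fun e => isOpen_const (p := cellMap (edgePt e 0) ∈ s),
    fun f => isOpen_const (p := cellMap (squarePt f 0 0) ∈ s)⟩

theorem continuous_coord : Continuous (coord (K := K)) := by
  simp only [continuous_sum_dom, continuous_sigma_iff]
  exact ⟨fun _ => continuous_const, fun _ => .prodMk_left 0, fun _ => continuous_id⟩

open Classical in
/-- A retraction of the cells to the vertices, which witnesses that different vertices are different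
points of the complex: an edge without its source goes to its target, and a square is first moved to
its right side, except for its left side. It is not continuous. -/
noncomputable def roundToVertex : K.Cells → K.V
  | .inl v => v.1
  | .inr (.inl p) => if p.2 = 0 then K.src p.1 else K.tgt p.1
  | .inr (.inr p) =>
    if p.2.1 = 0 then (if p.2.2 = 0 then K.src (K.left p.1) else K.tgt (K.left p.1))
    else if p.2.2 = 0 then K.src (K.right p.1) else K.tgt (K.right p.1)

theorem roundToVertex_eq {z z' : K.Cells} (hz : Glue z z') :
    roundToVertex z = roundToVertex z' := by
  cases hz <;>
    simp [roundToVertex, edgePt, squarePt, vertexPt, K.src_bottom, K.tgt_bottom, K.tgt_left,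
      K.tgt_right]

theorem vertexMap_injective : Function.Injective (vertexMap (K := K)) := fun _ _ h =>
  congrArg (Quot.lift roundToVertex fun _ _ => roundToVertex_eq) h

end SquareComplex

/-! ### Collapsing neighbourhoods of the ends of the interval -/

/-- A self-map of the interval which is constant near both ends and fixes them. -/
structure Collapse where
  toPath : Path (0 : I) 1
  eventually_zero : ∀ᶠ t in 𝓝 0, toPath t = 0
  eventually_one : ∀ᶠ t in 𝓝 1, toPath t = 1

namespace Collapse

variable (φ : Collapse)

/-- The points near which the collapse is constant with an end of the interval as its value. -/
def locus : Set I := {t | (∀ᶠ s in 𝓝 t, φ.toPath s = 0) ∨ ∀ᶠ s in 𝓝 t, φ.toPath s = 1}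

theorem zero_mem_locus : 0 ∈ φ.locus := .inl φ.eventually_zero

theorem one_mem_locus : 1 ∈ φ.locus := .inr φ.eventually_one

variable {φ}

theorem toPath_eq_of_mem_locus {t : I} (ht : t ∈ φ.locus) :
    φ.toPath t = 0 ∨ φ.toPath t = 1 :=
  ht.imp (·.self_of_nhds) (·.self_of_nhds)

theorem eventually_mem_locus {t : I} (ht : t ∈ φ.locus) :
    ∀ᶠ s in 𝓝 t, s ∈ φ.locus ∧ φ.toPath s = φ.toPath t := by
  rcases ht with ht | ht <;> filter_upwards [ht.eventually_nhds, ht] with s hs hs'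
  · exact ⟨.inl hs, hs'.trans ht.self_of_nhds.symm⟩
  · exact ⟨.inr hs, hs'.trans ht.self_of_nhds.symm⟩

theorem exists_Iio_subset_locus {r : ℝ} (hr0 : 0 < r) (hr1 : r < 1) :
    ∃ φ : Collapse, ∀ t : I, (t : ℝ) < r → t ∈ φ.locus := by
  let ψ (t : I) : I := projIcc 0 1 zero_le_one (2 * (t - r) / (1 - r))
  have ψ_zero {t : I} (ht : (t : ℝ) < r) : ψ t = 0 :=
    projIcc_of_le_left _ (div_nonpos_of_nonpos_of_nonneg (by linarith) (by linarith))
  have ψ_one {t : I} (ht : (1 + r) / 2 < t) : ψ t = 1 :=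
    projIcc_of_right_le _ ((one_le_div (by linarith)).2 (by linarith))
  have near_zero {t : I} (ht : (t : ℝ) < r) : ∀ᶠ s in 𝓝 t, ψ s = 0 :=
    (continuous_subtype_val.continuousAt.eventually_lt continuousAt_const ht).mono fun _ => ψ_zero
  have near_one : ∀ᶠ s in 𝓝 1, ψ s = 1 :=
    (continuousAt_const.eventually_lt continuous_subtype_val.continuousAt
      (show (1 + r) / 2 < (1 : ℝ) by linarith)).mono fun _ => ψ_one
  let φ : Collapse :=
    { toPath := ⟨⟨ψ, by fun_prop⟩, ψ_zero hr0, near_one.self_of_nhds⟩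
      eventually_zero := near_zero hr0
      eventually_one := near_one }
  exact ⟨φ, fun t ht => .inl (near_zero ht)⟩

theorem exists_mem_locus (a b : I) : ∃ φ : Collapse, a ∈ φ.locus ∧ b ∈ φ.locus := by
  have near_one (t : I) : ∀ᶠ r in 𝓝[<] (1 : ℝ), t = 1 ∨ (t : ℝ) < r := by
    rcases eq_or_ne t 1 with rfl | ht
    · simp
    · exact .mono (Ioo_mem_nhdsLT (unitInterval.lt_one_iff_ne_one.2 ht)) fun r hr => .inr hr.1
  obtain ⟨r, ⟨hr0, hr1⟩, ha, hb⟩ :=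
    (Filter.Eventually.and (Ioo_mem_nhdsLT zero_lt_one) ((near_one a).and (near_one b))).exists
  obtain ⟨φ, hφ⟩ := exists_Iio_subset_locus hr0 hr1
  have mem_locus {t : I} (ht : t = 1 ∨ (t : ℝ) < r) : t ∈ φ.locus :=
    ht.elim (fun ht => ht ▸ φ.one_mem_locus) (hφ t)
  exact ⟨φ, mem_locus ha, mem_locus hb⟩

variable (φ)

/-- A deformation of the identity of the interval into the collapse which fixes the ends. -/
noncomputable def homotopy : Path.Homotopy Path.id φ.toPath :=
  (SimplyConnectedSpace.paths_homotopic _ _).some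

/-- The tracks of the points of the square when both coordinates are deformed. -/
noncomputable def track : C(I × I, C(I, I × I)) :=
  ContinuousMap.curry ⟨fun q => (φ.homotopy (q.2, q.1.1), φ.homotopy (q.2, q.1.2)), by fun_prop⟩

theorem track_apply (p : I × I) (s : I) :
    φ.track p s = (φ.homotopy (s, p.1), φ.homotopy (s, p.2)) := rfl

theorem track_zero (p : I × I) : φ.track p 0 = p :=
  Prod.ext (φ.homotopy.apply_zero p.1) (φ.homotopy.apply_zero p.2)

theorem track_one (p : I × I) : φ.track p 1 = (φ.toPath p.1, φ.toPath p.2) :=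
  Prod.ext (φ.homotopy.apply_one p.1) (φ.homotopy.apply_one p.2)

end Collapse

namespace SquareComplex

variable {K : SquareComplex.{u}}

/-! ### Slides of the complex -/

theorem comp_track_eq (φ : Collapse) {z z' : K.Cells} (hz : Glue z z') :
    (cellMap z).comp (φ.track (coord z)) = (cellMap z').comp (φ.track (coord z')) := by
  have track_zero_left (t s : I) : φ.track (0, t) s = (0, (φ.track (t, 0) s).1) := by
    simp [Collapse.track_apply]
  have track_one_left (t s : I) : φ.track (1, t) s = (1, (φ.track (t, 0) s).1) := by
    simp [Collapse.track_apply]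
  have track_zero_right (t s : I) : φ.track (t, 0) s = ((φ.track (t, 0) s).1, 0) := by
    simp [Collapse.track_apply]
  have track_one_right (t s : I) : φ.track (t, 1) s = ((φ.track (t, 0) s).1, 1) := by
    simp [Collapse.track_apply]
  ext s
  cases hz with
  | src e => exact (congrArg (edgeMap e) (φ.homotopy.source s)).trans (edgeMap_zero e)
  | tgt e => exact (congrArg (edgeMap e) (φ.homotopy.target s)).trans (edgeMap_one e)
  | bottom f t =>
    exact (congrArg (squareMap f) (track_zero_right t s)).trans (proj_eq (.bottom f _))
  | top f t => exact (congrArg (squareMap f) (track_one_right t s)).trans (proj_eq (.top f _))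
  | left f t => exact (congrArg (squareMap f) (track_zero_left t s)).trans (proj_eq (.left f _))
  | right f t => exact (congrArg (squareMap f) (track_one_left t s)).trans (proj_eq (.right f _))

/-- The tracks of the points of the complex when the coordinates in all cells are deformed. -/
noncomputable def slide (φ : Collapse) : C(K.Realization, C(I, K.Realization)) where
  toFun := Quot.lift (fun z => (cellMap z).comp (φ.track (coord z))) fun _ _ => comp_track_eq φ
  continuous_toFun := by
    refine isQuotientMap_proj.continuous_iff.2 (continuous_iff_continuousAt.2 fun z => ?_)
    have hz : Continuous fun z' : K.Cells => (cellMap z).comp (φ.track (coord z')) :=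
      (ContinuousMap.continuous_postcomp _).comp (φ.track.continuous.comp continuous_coord)
    exact hz.continuousAt.congr ((isLocallyConstant_cellMap.eventually_eq z).mono fun z' h => by
      rw [← h]; rfl)

theorem slide_proj (φ : Collapse) (z : K.Cells) :
    slide φ (proj z) = (cellMap z).comp (φ.track (coord z)) := rfl

theorem slide_zero (φ : Collapse) (x : K.Realization) : slide φ x 0 = x := by
  obtain ⟨z, rfl⟩ := isQuotientMap_proj.surjective x
  rw [slide_proj, ContinuousMap.comp_apply, Collapse.track_zero, cellMap_coord]

/-- The points of the complex whose coordinates belong to the locus of the collapse. -/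
def locus (φ : Collapse) : Set K.Realization :=
  Quot.lift (fun z : K.Cells => coord z ∈ φ.locus ×ˢ φ.locus) fun _ _ hz => by
    cases hz <;>
      simp [coord, edgePt, squarePt, vertexPt, φ.zero_mem_locus, φ.one_mem_locus]

theorem proj_mem_locus {φ : Collapse} {z : K.Cells} :
    proj z ∈ locus φ ↔ coord z ∈ φ.locus ×ˢ φ.locus := Iff.rfl

theorem exists_mem_locus (x : K.Realization) : ∃ φ : Collapse, x ∈ locus φ := by
  obtain ⟨z, rfl⟩ := isQuotientMap_proj.surjective x
  exact Collapse.exists_mem_locus (coord z).1 (coord z).2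

theorem eventually_slide_one_eq {φ : Collapse} {x : K.Realization} (hx : x ∈ locus φ) :
    ∀ᶠ y in 𝓝 x, y ∈ locus φ ∧ slide φ y 1 = slide φ x 1 := by
  refine IsOpen.mem_nhds ?_ ⟨hx, rfl⟩
  refine isQuotientMap_proj.isOpen_preimage.1 (isOpen_iff_mem_nhds.2 fun z ⟨hz, hzx⟩ => ?_)
  obtain ⟨h₁, h₂⟩ := proj_mem_locus.1 hz
  have hc := (continuous_coord (K := K)).continuousAt (x := z)
  filter_upwards [isLocallyConstant_cellMap.eventually_eq z,
    hc.fst.eventually (Collapse.eventually_mem_locus h₁),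
    hc.snd.eventually (Collapse.eventually_mem_locus h₂)] with z' hcell h₁' h₂'
  refine ⟨⟨h₁'.1, h₂'.1⟩, ?_⟩
  rw [← hzx, slide_proj, slide_proj, ContinuousMap.comp_apply, ContinuousMap.comp_apply,
    Collapse.track_one, Collapse.track_one, hcell, h₁'.2, h₂'.2]

/-! ### Extending path classes from the vertices to the complex -/

section Extend

variable {b : K.Realization} {h : ∀ x : K.Realization, Path.Homotopic.Quotient x b}

theorem isFlat_side {f : K.F} {e : K.E} {k : C(I, I × I)} (hk : (squareMap f).comp k = edgeMap e)
    (he : IsFlat h (edgeMap e) 0 1) : IsFlat h (squareMap f) (k 0) (k 1) :=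
  IsFlat.of_comp (hk ▸ he)

theorem isFlat_corner (he : ∀ e, IsFlat h (edgeMap e) 0 1) (z : K.Cells) {s t : I}
    (hs : s = 0 ∨ s = 1) (ht : t = 0 ∨ t = 1) : IsFlat h (cellMap z) (s, t) (1, 1) := by
  rcases z with v | ⟨e, -⟩ | ⟨f, -⟩
  · exact .const _ _ _
  · refine IsFlat.comp (k := .fst) ?_
    rcases hs with rfl | rfl
    · exact he e
    · exact .refl _ _
  · have top : IsFlat h (squareMap f) (0, 1) (1, 1) := isFlat_side (squareMap_top f) (he _)
    have left : IsFlat h (squareMap f) (0, 0) (0, 1) := isFlat_side (squareMap_left f) (he _)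
    have right : IsFlat h (squareMap f) (1, 0) (1, 1) := isFlat_side (squareMap_right f) (he _)
    rcases hs with rfl | rfl <;> rcases ht with rfl | rfl
    exacts [left.trans top, top, right, .refl _ _]

theorem exists_isFlat_extension (d : ∀ v : K.V, Path.Homotopic.Quotient (vertexMap v) b) :
    ∃ h : ∀ x : K.Realization, Path.Homotopic.Quotient x b, (∀ v, h (vertexMap v) = d v) ∧
      ∀ x, ∃ z, proj z = x ∧ IsFlat h (cellMap z) (coord z) (1, 1) := by
  have exists_class : ∀ x : K.Realization, ∃ c : Path.Homotopic.Quotient x b,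
      (∀ v, vertexMap v = x → c ≍ d v) ∧ ∃ z v, ∃ p : Path x (vertexMap v),
        ∃ q : Path (coord z) (1, 1), (∀ t, p t = cellMap z (q t)) ∧ c = .trans (.mk p) (d v) := by
    intro x
    by_cases hx : ∃ v, vertexMap v = x
    · obtain ⟨v, rfl⟩ := hx
      refine ⟨d v, fun w hw => by cases vertexMap_injective hw; rfl, vertexPt v, v, .refl _,
        PathConnectedSpace.somePath _ _, fun _ => rfl, ?_⟩
      simp
    · obtain ⟨z, rfl⟩ := isQuotientMap_proj.surjective x
      obtain ⟨v, hv⟩ := exists_cellMap_one_eq z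
      let q : Path (coord z) (1, 1) := PathConnectedSpace.somePath _ _
      let p : Path (proj z) (vertexMap v) :=
        (q.map (cellMap z).continuous).cast (cellMap_coord z).symm hv.symm
      exact ⟨.trans (.mk p) (d v), fun w hw => (hx ⟨w, hw⟩).elim, z, v, p, q, fun _ => rfl, rfl⟩
  choose h hd z v p q hpq hp using exists_class
  have hvertex (v) : h (vertexMap v) = d v := eq_of_heq (hd _ v rfl)
  refine ⟨h, hvertex, fun x => ⟨z x, ?_, ?_⟩⟩
  · simpa [cellMap_coord] using (hpq x 0).symm
  · have parallel : IsParallel h (p x) := by rw [IsParallel, hvertex, ← hp]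
    exact .of_path (p := q x) (parallel.congr (hpq x))

theorem isFlat_slide (he : ∀ e, IsFlat h (edgeMap e) 0 1) {φ : Collapse} {x : K.Realization}
    (hx : x ∈ locus φ) (hcell : ∃ z, proj z = x ∧ IsFlat h (cellMap z) (coord z) (1, 1)) :
    IsFlat h (slide φ x) 0 1 := by
  obtain ⟨z, rfl, hz⟩ := hcell
  obtain ⟨h₁, h₂⟩ := proj_mem_locus.1 hx
  refine IsFlat.comp (k := φ.track (coord z)) ?_
  rw [Collapse.track_zero, Collapse.track_one]
  exact hz.trans (isFlat_corner he z (Collapse.toPath_eq_of_mem_locus h₁)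
    (Collapse.toPath_eq_of_mem_locus h₂)).symm

theorem isParallel_of_slide_one_eq {φ : Collapse} {c x y : K.Realization} {p : Path x y}
    (hp : ∀ t, IsFlat h (slide φ (p t)) 0 1) (hc : ∀ t, slide φ (p t) 1 = c) :
    IsParallel h p := by
  let G : C(I × I, K.Realization) := ((slide φ).comp p.toContinuousMap).uncurry
  have side (s : I) : IsFlat h G (s, 0) (s, 1) := IsFlat.of_comp (k := vertical s) (hp s)
  have top : IsFlat h G (0, 1) (1, 1) := by
    refine IsFlat.of_comp (k := horizontal 1) (u := (0 : I)) (v := 1) ?_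
    rw [show G.comp (horizontal 1) = .const I c from ContinuousMap.ext hc]
    exact .const _ _ _
  have bottom : IsFlat h G (0, 0) (1, 0) := ((side 0).trans top).trans (side 1).symm
  exact (bottom (Path.id.prod (.refl 0))).congr fun t => slide_zero φ (p t)

end Extend

/-! ### Edge paths -/

/-- The edges from `v` to `w`. -/
def EdgeBetween (v w : K.V) : Type u := {e : K.E // K.src e = v ∧ K.tgt e = w}

/-- An edge as a path between its ends. -/
def EdgeBetween.path {v w : K.V} (e : EdgeBetween v w) : Path (vertexMap v) (vertexMap w) where
  toContinuousMap := edgeMap e.1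
  source' := (edgeMap_zero e.1).trans (congrArg vertexMap e.2.1)
  target' := (edgeMap_one e.1).trans (congrArg vertexMap e.2.2)

theorem simplyConnectedSpace_of_edges {b : K.Realization}
    (d : ∀ v : K.V, Path.Homotopic.Quotient (vertexMap v) b)
    (hd : ∀ {v w : K.V} (e : EdgeBetween v w), d v = .trans (.mk e.path) (d w)) :
    SimplyConnectedSpace K.Realization := by
  obtain ⟨h, hvertex, hcell⟩ := exists_isFlat_extension d
  have hedge (e : K.E) : IsFlat h (edgeMap e) 0 1 := by
    let e' : EdgeBetween (K.src e) (K.tgt e) := ⟨e, rfl, rfl⟩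
    have parallel : IsParallel h e'.path := by rw [IsParallel, hvertex, hvertex, ← hd]
    exact .of_path (p := Path.id) (parallel.congr fun _ => rfl)
  refine simplyConnectedSpace_of_isParallel (h := h) (IsParallel.of_local fun x => ?_)
  obtain ⟨φ, hx⟩ := exists_mem_locus x
  exact ⟨_, eventually_slide_one_eq hx, fun p hp => isParallel_of_slide_one_eq
    (fun t => isFlat_slide hedge (hp t).1 (hcell _)) fun t => (hp t).2⟩

theorem EdgeBetween.homotopic_of_square {v w w' u : K.V} (f : K.F) {e : EdgeBetween v w}
    {e' : EdgeBetween v w'} {r : EdgeBetween w u} {t : EdgeBetween w' u} (he : K.bottom f = e.1)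
    (hr : K.right f = r.1) (he' : K.left f = e'.1) (ht : K.top f = t.1) :
    (e.path.trans r.path).Homotopic (e'.path.trans t.path) := by
  let q : Path ((0, 0) : I × I) (1, 1) := (Path.id.prod (.refl 0)).trans ((Path.refl 1).prod .id)
  let q' : Path ((0, 0) : I × I) (1, 1) := ((Path.refl 0).prod .id).trans (Path.id.prod (.refl 1))
  have bottom : (squareMap f).comp (horizontal 0) = edgeMap e.1 := he ▸ squareMap_bottom f
  have right : (squareMap f).comp (vertical 1) = edgeMap r.1 := hr ▸ squareMap_right f
  have left : (squareMap f).comp (vertical 0) = edgeMap e'.1 := he' ▸ squareMap_left f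
  have top : (squareMap f).comp (horizontal 1) = edgeMap t.1 := ht ▸ squareMap_top f
  refine homotopic_of_eq_comp (squareMap f) q q' (fun s => ?_) fun s => ?_
  · simp only [q, Path.trans_apply]
    split_ifs
    exacts [(ContinuousMap.congr_fun bottom _).symm, (ContinuousMap.congr_fun right _).symm]
  · simp only [q', Path.trans_apply]
    split_ifs
    exacts [(ContinuousMap.congr_fun left _).symm, (ContinuousMap.congr_fun top _).symm]

/-! ### The diamond lemma -/

/-- A complex with the properties which the diamond lemma asks for: no infinite edge path follows
the directions of the edges, `v₀` is the only vertex where no edge starts, and any two edges with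
the same source are the sides of a square, in one of the two orders. -/
structure IsDiamond (K : SquareComplex.{u}) (v₀ : K.V) : Prop where
  wellFounded : WellFounded fun w v : K.V => Nonempty (EdgeBetween v w)
  exists_src_eq_iff (v : K.V) : (∃ e, K.src e = v) ↔ v ≠ v₀
  exists_square (e e' : K.E) : K.src e = K.src e' → e ≠ e' →
    ∃ f, (K.bottom f = e ∧ K.left f = e') ∨ (K.bottom f = e' ∧ K.left f = e)

namespace IsDiamond

variable {v₀ : K.V}

theorem exists_homotopic (hK : K.IsDiamond v₀) {v w w' : K.V} (e : EdgeBetween v w)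
    (e' : EdgeBetween v w') (hne : e.1 ≠ e'.1) :
    ∃ (u : K.V) (r : EdgeBetween w u) (t : EdgeBetween w' u),
      (e.path.trans r.path).Homotopic (e'.path.trans t.path) := by
  obtain ⟨f, ⟨hb, hl⟩ | ⟨hb, hl⟩⟩ := hK.exists_square e.1 e'.1 (e.2.1.trans e'.2.1.symm) hne
  · have hr : K.src (K.right f) = w := by rw [← K.tgt_bottom, hb, e.2.2]
    have ht : K.src (K.top f) = w' := by rw [← K.tgt_left, hl, e'.2.2]
    exact ⟨_, ⟨K.right f, hr, K.tgt_right f⟩, ⟨K.top f, ht, rfl⟩,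
      EdgeBetween.homotopic_of_square f hb rfl hl rfl⟩
  · have hr : K.src (K.right f) = w' := by rw [← K.tgt_bottom, hb, e'.2.2]
    have ht : K.src (K.top f) = w := by rw [← K.tgt_left, hl, e.2.2]
    exact ⟨_, ⟨K.top f, ht, rfl⟩, ⟨K.right f, hr, K.tgt_right f⟩,
      (EdgeBetween.homotopic_of_square f hb rfl hl rfl).symm⟩

theorem exists_descent (hK : K.IsDiamond v₀) :
    ∃ d : ∀ v : K.V, Path.Homotopic.Quotient (vertexMap v) (vertexMap v₀),
      ∀ v ≠ v₀, ∃ (w : K.V) (e : EdgeBetween v w), d v = .trans (.mk e.path) (d w) := by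
  have exists_edge (v : K.V) (hv : v ≠ v₀) : ∃ w, Nonempty (EdgeBetween v w) := by
    obtain ⟨e, he⟩ := (hK.exists_src_eq_iff v).2 hv
    exact ⟨K.tgt e, ⟨e, he, rfl⟩⟩
  choose w e using exists_edge
  have exists_step (v : K.V) (d : ∀ w, Nonempty (EdgeBetween v w) →
      Path.Homotopic.Quotient (vertexMap w) (vertexMap v₀)) :
      ∃ c : Path.Homotopic.Quotient (vertexMap v) (vertexMap v₀),
        ∀ hv : v ≠ v₀, c = .trans (.mk (e v hv).some.path) (d (w v hv) (e v hv)) := by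
    by_cases hv : v = v₀
    · subst hv
      exact ⟨.refl _, fun hv => (hv rfl).elim⟩
    · exact ⟨.trans (.mk (e v hv).some.path) (d (w v hv) (e v hv)), fun _ => rfl⟩
  choose c hc using exists_step
  refine ⟨hK.wellFounded.fix c, fun v hv => ⟨w v hv, (e v hv).some, ?_⟩⟩
  rw [hK.wellFounded.fix_eq, hc v _ hv]

theorem simplyConnectedSpace (hK : K.IsDiamond v₀) : SimplyConnectedSpace K.Realization := by
  obtain ⟨d, hd⟩ := hK.exists_descent
  refine simplyConnectedSpace_of_edges d fun {v} => ?_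
  induction v using hK.wellFounded.induction with
  | _ v ih =>
  intro w e
  obtain ⟨w', e', he'⟩ := hd v ((hK.exists_src_eq_iff v).1 ⟨e.1, e.2.1⟩)
  by_cases hne : e.1 = e'.1
  · obtain rfl : w = w' := by rw [← e.2.2, hne, e'.2.2]
    rwa [show e = e' from Subtype.ext hne]
  obtain ⟨u, r, t, hrt⟩ := hK.exists_homotopic e e' hne
  calc d v = .trans (.mk e'.path) (.trans (.mk t.path) (d u)) := by rw [he', ← ih w' ⟨e'⟩ t]
    _ = .trans (.mk (e'.path.trans t.path)) (d u) := by
      rw [Path.Homotopic.Quotient.mk_trans, Path.Homotopic.Quotient.trans_assoc]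
    _ = .trans (.mk (e.path.trans r.path)) (d u) := by rw [Path.Homotopic.Quotient.eq.2 hrt]
    _ = .trans (.mk e.path) (.trans (.mk r.path) (d u)) := by
      rw [Path.Homotopic.Quotient.mk_trans, Path.Homotopic.Quotient.trans_assoc]
    _ = .trans (.mk e.path) (d w) := by rw [← ih w ⟨e⟩ r]

end IsDiamond

end SquareComplex

/-! ### Cut systems on surfaces of genus zero -/

theorem isPreconnected_sdiff {X : Type*} [TopologicalSpace X] {N W A : Set X}
    (hN : IsPreconnected N) (hW : IsOpen W) (hA : IsClosed A) (hAW : A ⊆ W) (hWN : W ⊆ N)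
    (hWA : IsPreconnected (W \ A)) : IsPreconnected (N \ A) := by
  rw [isPreconnected_iff_subset_of_disjoint]
  intro P Q hP hQ hNPQ hPQ
  have hsub : W \ A ⊆ N \ A := sdiff_subset_sdiff_left hWN
  have hWPQ : W \ A ∩ (P ∩ Q) = ∅ := subset_empty_iff.1 (hPQ ▸ inter_subset_inter_left _ hsub)
  wlog hWP : W \ A ⊆ P generalizing P Q
  · have hWQ := (isPreconnected_iff_subset_of_disjoint.1 hWA P Q hP hQ (hsub.trans hNPQ)
      hWPQ).resolve_left hWP
    exact (this Q P hQ hP (union_comm P Q ▸ hNPQ) (inter_comm P Q ▸ hPQ) (inter_comm P Q ▸ hWPQ)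
      hWQ).symm
  have cover : N ⊆ (P ∪ W) ∪ (Q \ A) := fun x hx => by
    have := @hNPQ x
    have := @hAW x
    grind
  have disjoint : N ∩ ((P ∪ W) ∩ (Q \ A)) = ∅ := by
    refine subset_empty_iff.1 fun x ⟨hxN, hx, hxQ, hxA⟩ => ?_
    have hxP : x ∈ P := hx.elim id fun hxW => hWP ⟨hxW, hxA⟩
    exact hPQ ▸ (show x ∈ N \ A ∩ (P ∩ Q) from ⟨⟨hxN, hxA⟩, hxP, hxQ⟩)
  rcases isPreconnected_iff_subset_of_disjoint.1 hN _ _ (hP.union hW) (hQ.sdiff hA) cover disjoint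
    with h | h
  · exact .inl fun x hx => (h hx.1).elim id fun hxW => hWP ⟨hxW, hx.2⟩
  · exact .inr fun x hx => (h hx.1).1

section Genus

variable {M : Type*} [TopologicalSpace M] [ChartedSpace (EuclideanHalfSpace 2) M]

theorem IsCurveSystem.isClosed [T2Space M] {C : Set (Set M)} (hC : IsCurveSystem C) :
    IsClosed (⋃₀ C) := by
  refine sUnion_eq_biUnion ▸ hC.1.isClosed_biUnion fun c hc => ?_
  obtain ⟨⟨γ, hγ, rfl⟩, -⟩ := hC.2.1 c hc
  exact (isCompact_range hγ.isEmbedding.continuous).isClosed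

theorem IsCurveSystem.mono {C C' : Set (Set M)} (hC : IsCurveSystem C) (h : C' ⊆ C) :
    IsCurveSystem C' :=
  ⟨hC.1.subset h, fun c hc => hC.2.1 c (h hc), hC.2.2.subset h⟩

theorem isCurveSystem_empty : IsCurveSystem (∅ : Set (Set M)) :=
  ⟨finite_empty, fun _ h => h.elim, pairwiseDisjoint_empty⟩

theorem genus_le_of_subset [T2Space M] {W U : Set M} (hWU : W ⊆ U) (hW : IsOpen W)
    (hWc : IsPreconnected W) : genus W ≤ genus U := by
  refine iSup_le fun ⟨F, hF, hFW, hFn⟩ => ?_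
  refine le_iSup_of_le (⟨F, hF, hFW.trans hWU, fun y hy => ?_⟩ :
    {F : Set (Set M) // IsCurveSystem F ∧ ⋃₀ F ⊆ U ∧ IsNonseparating U F}) le_rfl
  rcases (connectedComponentIn U y ∩ W).eq_empty_or_nonempty with hyW | ⟨x, hxy, hxW⟩
  · have : Disjoint (connectedComponentIn U y) (⋃₀ F) :=
      (disjoint_iff_inter_eq_empty.2 hyW).mono_right hFW
    rw [this.sdiff_eq_left]
    exact isConnected_connectedComponentIn_iff.2 hy
  · have hWN : W ⊆ connectedComponentIn U y := by
      rw [connectedComponentIn_eq hxy]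
      exact hWc.subset_connectedComponentIn hxW hWU
    have hWF : IsConnected (W \ ⋃₀ F) := by
      have := hFn x hxW
      rwa [hWc.connectedComponentIn hxW] at this
    exact ⟨hWF.nonempty.mono (sdiff_subset_sdiff_left hWN),
      isPreconnected_sdiff isPreconnected_connectedComponentIn hW hF.isClosed hFW hWN
        hWF.isPreconnected⟩

theorem IsCurveSystem.isCutSystem [T2Space M] (hM : genus (univ : Set M) = 0) {C : Set (Set M)}
    (hC : IsCurveSystem C) : IsCutSystem C := by
  have : LocallyConnectedSpace M := ChartedSpace.locallyConnectedSpace (EuclideanHalfSpace 2) M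
  refine ⟨hC, fun x _ => nonpos_iff_eq_zero.1 (le_of_le_of_eq ?_ hM)⟩
  exact genus_le_of_subset (subset_univ _) hC.isClosed.isOpen_compl.connectedComponentIn
    isPreconnected_connectedComponentIn

end Genus

namespace ESurface

variable {M : Type u} [TopologicalSpace M] [ChartedSpace (EuclideanHalfSpace 2) M]
  (S : ESurface M)

/-- The number of cuts, which is an isotopy invariant of cut systems and decreases along edges. -/
noncomputable def cutCount : S.Vertex → ℕ :=
  Quotient.lift (fun C => C.cuts.ncard) fun C C' ⟨φ, _, h⟩ => by
    rw [← h, moveCurves, ncard_image_of_injective _ φ.injective.image_injective]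

theorem cutCount_target_lt (e : S.Edge) : S.cutCount (S.target e) < S.cutCount (S.source e) := by
  induction e using Quotient.inductionOn with
  | h p => exact ncard_sdiff_singleton_lt_of_mem p.mem p.isCutSystem.1.1

theorem wellFounded_edgeBetween :
    WellFounded fun w v : (cutComplex S).V => Nonempty (SquareComplex.EdgeBetween v w) := by
  refine Subrelation.wf ?_ (measure S.cutCount).wf
  rintro _ _ ⟨e, rfl, rfl⟩
  exact S.cutCount_target_lt e

theorem edge_eq {p p' : PointedCutSystem M} {φ : M ≃ₜ M} (hφ : S.IsotopicToId φ)
    (hcuts : moveCurves φ p.cuts = p'.cuts) (hc : φ '' p.c = p'.c) : S.edge p = S.edge p' :=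
  Quotient.sound (s := S.pointedSetoid) ⟨φ, hφ, hcuts, hc⟩

theorem exists_cell_edge_eq (q : BipointedCutSystem M) :
    ∃ f : S.Cell, (S.edge f.out.first₁ = S.edge q.first₁ ∧ S.edge f.out.first₂ = S.edge q.first₂) ∨
      (S.edge f.out.first₁ = S.edge q.first₂ ∧ S.edge f.out.first₂ = S.edge q.first₁) := by
  let f : S.Cell := Quotient.mk S.bipointedSetoid q
  obtain ⟨ψ, hψ, hcuts, hpair⟩ : S.bipointedSetoid f.out q :=
    Quotient.mk_out (s := S.bipointedSetoid) q
  rw [moveCurves, image_pair, pair_eq_pair_iff] at hpair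
  exact ⟨f, hpair.imp (fun h => ⟨S.edge_eq hψ hcuts h.1, S.edge_eq hψ hcuts h.2⟩)
    fun h => ⟨S.edge_eq hψ hcuts h.1, S.edge_eq hψ hcuts h.2⟩⟩

variable [T2Space M]

theorem exists_bipointed (hS : S.surfaceGenus = 0) {e e' : S.Edge}
    (he : S.source e = S.source e') (hne : e ≠ e') :
    ∃ q : BipointedCutSystem M, S.edge q.first₁ = e ∧ S.edge q.first₂ = e' := by
  obtain ⟨p, rfl⟩ : ∃ p, S.edge p = e := Quotient.exists_rep e
  obtain ⟨p', rfl⟩ : ∃ p', S.edge p' = e' := Quotient.exists_rep e'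
  obtain ⟨φ, hφ, hcuts⟩ := Quotient.exact he
  replace hcuts : moveCurves φ p.cuts = p'.cuts := hcuts
  have hmem : φ '' p.c ∈ p'.cuts := hcuts ▸ mem_image_of_mem _ p.mem
  have hcut (C) (hC : C ⊆ p'.cuts) : IsCutSystem C := (p'.isCutSystem.1.mono hC).isCutSystem hS
  let q : BipointedCutSystem M :=
    { cuts := p'.cuts
      c₁ := φ '' p.c
      c₂ := p'.c
      mem₁ := hmem
      mem₂ := p'.mem
      ne := fun hc => hne (S.edge_eq hφ hcuts hc)
      isCutSystem := p'.isCutSystem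
      removable₁ := hcut _ sdiff_subset
      removable₂ := p'.removable
      removable₁₂ := hcut _ (sdiff_subset.trans sdiff_subset) }
  exact ⟨q, (S.edge_eq (p' := q.first₁) hφ hcuts rfl).symm, rfl⟩

theorem exists_source_eq_iff (hS : S.surfaceGenus = 0) (v : S.Vertex) :
    (∃ e, S.source e = v) ↔ v ≠ S.vertex ⟨∅, isCurveSystem_empty.isCutSystem hS⟩ := by
  constructor
  · rintro ⟨e, rfl⟩ he
    have hlt := S.cutCount_target_lt e
    have hzero : S.cutCount (S.source e) = 0 := (congrArg S.cutCount he).trans (ncard_empty _)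
    exact (hzero ▸ hlt).not_ge (Nat.zero_le _)
  · intro hv
    obtain ⟨⟨C, hC⟩, rfl⟩ := Quotient.exists_rep v
    obtain ⟨c, hc⟩ : C.Nonempty := nonempty_iff_ne_empty.2 fun h => hv (by subst h; rfl)
    exact ⟨S.edge ⟨C, c, hc, hC, (hC.1.mono sdiff_subset).isCutSystem hS⟩, rfl⟩

theorem isDiamond (hS : S.surfaceGenus = 0) :
    (cutComplex S).IsDiamond (S.vertex ⟨∅, isCurveSystem_empty.isCutSystem hS⟩) where
  wellFounded := S.wellFounded_edgeBetween
  exists_src_eq_iff := S.exists_source_eq_iff hS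
  exists_square e e' he hne := by
    obtain ⟨q, rfl, rfl⟩ := S.exists_bipointed hS he hne
    exact S.exists_cell_edge_eq q

end ESurface

end CutComplex

theorem mainTheorem6_general {M : Type*} [TopologicalSpace M]
    [ChartedSpace (EuclideanHalfSpace 2) M] [T2Space M] (S : CutComplex.ESurface M)
    (hS : S.surfaceGenus = 0) : SimplyConnectedSpace (CutComplex.cutComplex S).Realization :=
  (S.isDiamond hS).simplyConnectedSpace

theorem mainTheorem6 {M : Type*} [TopologicalSpace M] [ChartedSpace (EuclideanHalfSpace 2) M]
    [IsManifold (𝓡∂ 2) ∞ M] [T2Space M] [CompactSpace M]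
    (S : CutComplex.ESurface M) (hS : S.surfaceGenus = 0) :
    ConnectedSpace (CutComplex.cutComplex S).Realization ∧
      SimplyConnectedSpace (CutComplex.cutComplex S).Realization := by
  have := mainTheorem6_general S hS
  exact ⟨inferInstance, this⟩
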